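/- Let $G$ be a finite simple undirected graph with vertex set $V$, $N=|V|$, and edge set $E$. A path is a finite sequence of vertices in which consecutive vertices are adjacent; vertices and edges may be repeated. A vertex is unbounded in a path if the path visits it more than once. A $k$-Unbounded Hamiltonian Cycle of $G$ is a path that visits every vertex of $G$, has exactly $k$ unbounded vertices, and whose first and last vertices are adjacent. Suppose that $G$ has a $k$-Unbounded Hamiltonian Cycle for some $k$, and let $m$ be the least such $k$. Construct a weighted digraph $D$ as follows. Replace each $v\in V$ by a gadget with the $3N$ vertices $v_{a_1},\dots,v_{a_N},v_{b_1},\dots,v_{b_N},v_{c_1},\dots,v_{c_N}$. For every ordered pair $(v,k)$ of adjacent vertices of $G$ there is an arc $v_i\to k_j$ for all $i\in\{c_1,\dots,c_N,a_1\}$ and $j\in\{a_1,\dots,a_N,c_N\}$. Inside the gadget of $v$ there are, in both directions, the arcs between $v_{a_i}$ and $v_{b_i}$ and between $v_{b_i}$ and $v_{c_i}$ for $1\le i\le N$, and between $v_{a_i}$ and $v_{c_{i-1}}$ for $2\le i\le N$. In each gadget one downward arc, of the form $v_{a_i}\to v_{b_i}$ or $v_{b_i}\to v_{c_i}$, is chosen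 arbitrarily and given weight $1$; all other arcs of $D$ have weight $0$. An ATSP tour is a directed Hamiltonian cycle of $D$; its weight is the sum of the weights of its arcs. Then: 1. $D$ has $3N^2$ vertices and $2|E|(N+1)^2+2N(3N-1)$ arcs. 2. $D$ has an ATSP tour, and the minimum weight of an ATSP tour is $m$. 3. For every ATSP tour of minimum weight, listed from any starting vertex, replacing each gadget vertex by the vertex of $G$ it belongs to and then reducing each block of (cyclically) consecutive equal entries to a single entry gives an $m$-Unbounded Hamiltonian Cycle of $G$. -/

import Mathlib

namespace UnboundedHam

section Walks

variable {V : Type*} [Fintype V] [DecidableEq V] {G : SimpleGraph V} {u v : V}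

/-- The unbounded vertices of a path (vertices and edges may be repeated, so a walk):
those that it visits more than once. -/
def unboundedVertices (p : G.Walk u v) : Finset V :=
  Finset.univ.filter fun w => 2 ≤ p.support.count w

/-- A `k`-Unbounded Hamiltonian Path visits every vertex and has exactly `k` unbounded vertices. -/
def IsUnboundedHamPath (k : ℕ) (p : G.Walk u v) : Prop :=
  (∀ w, w ∈ p.support) ∧ (unboundedVertices p).card = k

/-- A `k`-Unbounded Hamiltonian Cycle is a `k`-Unbounded Hamiltonian Path whose first and last
vertices are adjacent. -/
def IsUnboundedHamCycle (k : ℕ) (p : G.Walk u v) : Prop :=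
  IsUnboundedHamPath k p ∧ G.Adj v u

end Walks

/-- `m` is the minimum `k` for which `G` has a `k`-Unbounded Hamiltonian Cycle. -/
def IsMinUnbounded {V : Type*} [Fintype V] [DecidableEq V] (G : SimpleGraph V) (m : ℕ) : Prop :=
  IsLeast {k | ∃ (u v : V) (p : G.Walk u v), IsUnboundedHamCycle k p} m

/-- The three rows of a gadget. -/
inductive Row
  | a
  | b
  | c
  deriving DecidableEq

instance : Fintype Row where
  elems := {Row.a, Row.b, Row.c}
  complete x := by cases x <;> simp

/-- Positions in a gadget with `n` columns. Columns are numbered from `0`, so `(i, Row.a)` is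
the vertex usually written `a_{i+1}`. -/
abbrev Pos (n : ℕ) : Type := Fin n × Row

/-- Arcs leaving the gadget start in `{c_1, …, c_n, a_1}`. -/
def IsOutPort {n : ℕ} (x : Pos n) : Prop :=
  x.2 = Row.c ∨ (x.2 = Row.a ∧ (x.1 : ℕ) = 0)

/-- Arcs entering the gadget end in `{a_1, …, a_n, c_n}`. -/
def IsInPort {n : ℕ} (x : Pos n) : Prop :=
  x.2 = Row.a ∨ (x.2 = Row.c ∧ (x.1 : ℕ) + 1 = n)

/-- The edges `a_i b_i`, `b_i c_i` and `a_{i+1} c_i` inside a gadget, in one orientation. -/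
def InnerEdge {n : ℕ} (x y : Pos n) : Prop :=
  (x.2 = Row.a ∧ y.2 = Row.b ∧ x.1 = y.1) ∨
  (x.2 = Row.b ∧ y.2 = Row.c ∧ x.1 = y.1) ∨
  (x.2 = Row.a ∧ y.2 = Row.c ∧ (x.1 : ℕ) = (y.1 : ℕ) + 1)

/-- The downward arcs of a gadget: `a_i → b_i` and `b_i → c_i`. -/
inductive DownArc (n : ℕ)
  | ab (i : Fin n)
  | bc (i : Fin n)

/-- The start of a downward arc. -/
def DownArc.tail {n : ℕ} : DownArc n → Pos n
  | .ab i => (i, Row.a)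
  | .bc i => (i, Row.b)

/-- The end of a downward arc. -/
def DownArc.head {n : ℕ} : DownArc n → Pos n
  | .ab i => (i, Row.b)
  | .bc i => (i, Row.c)

/-- The vertices of the constructed digraph: one gadget with `N = |V|` columns per vertex. -/
abbrev AtspVertex (V : Type*) [Fintype V] : Type _ := V × Pos (Fintype.card V)

/-- The constructed digraph. Inner edges are present in both directions. -/
def atspDigraph {V : Type*} [Fintype V] (G : SimpleGraph V) : Digraph (AtspVertex V) where
  Adj x y :=
    (x.1 = y.1 ∧ (InnerEdge x.2 y.2 ∨ InnerEdge y.2 x.2)) ∨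
    (G.Adj x.1 y.1 ∧ IsOutPort x.2 ∧ IsInPort y.2)

/-- The arc weights, where `d v` is the chosen downward arc in the gadget of `v`: the chosen arcs
have weight `1`, all others have weight `0`. -/
def atspWeight {V : Type*} [Fintype V] [DecidableEq V]
    (d : V → DownArc (Fintype.card V)) (x y : AtspVertex V) : ℕ :=
  if x.1 = y.1 ∧ x.2 = (d x.1).tail ∧ y.2 = (d x.1).head then 1 else 0

/-- The pairs of cyclically consecutive entries of a list (the last entry is followed by the
first). -/
def cyclicPairs {X : Type*} (T : List X) : List (X × X) := T.zip (T.rotate 1)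

/-- An ATSP tour: a directed Hamiltonian cycle, listed from an arbitrary starting vertex. -/
def IsTour {X : Type*} (D : Digraph X) (T : List X) : Prop :=
  T ≠ [] ∧ T.Nodup ∧ (∀ x, x ∈ T) ∧ ∀ e ∈ cyclicPairs T, D.Adj e.1 e.2

/-- The total weight of the arcs of a tour. -/
def tourWeight {X : Type*} (c : X → X → ℕ) (T : List X) : ℕ :=
  ((cyclicPairs T).map fun e => c e.1 e.2).sum

/-- An optimal ATSP tour. -/
def IsOptimalTour {X : Type*} (D : Digraph X) (c : X → X → ℕ) (T : List X) : Prop :=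
  IsTour D T ∧ ∀ T', IsTour D T' → tourWeight c T ≤ tourWeight c T'

/-- Reduces each block of cyclically consecutive equal entries to a single entry: `destutter`
does this inside the list; if the last block then equals the first one, it is merged into it. -/
def cyclicReduce {X : Type*} [DecidableEq X] (l : List X) : List X :=
  let r := l.destutter (· ≠ ·)
  if 2 ≤ r.length ∧ r.head? = r.getLast? then r.dropLast else r

/-- The sequence of vertices of `G` read off from a list of gadget vertices. -/
def readOff {V : Type*} [Fintype V] [DecidableEq V] (T : List (AtspVertex V)) : List V :=
  cyclicReduce (T.map Prod.fst)

end UnboundedHam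

/-!
The inner arcs of a gadget join consecutive vertices of the path `a_1, b_1, c_1, a_2, …, c_N`, in
both directions. A vertex `b_i` has no other neighbours than `a_i` and `c_i`, so a tour runs
through column `i` either downwards, `a_i → b_i → c_i`, or upwards, `c_i → b_i → a_i`. If it goes
upwards, then `a_i` can only be left towards `c_{i-1}` and `c_i` can only be reached from
`a_{i+1}`, so the neighbouring columns are upwards too: each gadget is either entirely upwards or
entirely downwards (`IsUpColumn.all`). An upward gadget is run through in one go, from `c_N` to
`a_1`, and has weight `0`. A downward gadget uses all of its downward arcs, hence has weight `1`
whichever of them was chosen.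

*Lower bound.* Reading off the vertices of `G` along a tour gives an Unbounded Hamiltonian Cycle,
and a vertex whose gadget is upwards is visited once. So at most as many vertices are unbounded as
there are downward gadgets, and their number is the weight
(`exists_isUnboundedHamCycle_readOff`). For a tour of weight `m`, minimality of `m` forces equality.

*Upper bound.* In an Unbounded Hamiltonian Cycle with `m` unbounded vertices, give each vertex
visited once an upward gadget, and let the successive visits to any other vertex take the columns
of its gadget downwards, one column each and all the rest at the last visit
(`exists_tour_of_isUnboundedHamCycle`). This needs that no vertex is visited more than `N` times,
which holds in a shortest such cycle: if `v` is visited more than `N` times, one of the at least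
`N` stretches between consecutive visits to `v` contains only vertices also visited elsewhere, as
there are only `N - 1` vertices besides `v`; cutting it out leaves a shorter Unbounded Hamiltonian
Cycle with no more unbounded vertices (`exists_isUnboundedHamCycle_count_le`).
-/

namespace UnboundedHam

/-! ### Cyclically consecutive pairs -/

section CyclicPairs

variable {X : Type*}

theorem zip_append_singleton (a b : X) (l : List X) :
    (a :: l).zip (l ++ [b]) = (a :: l).zip l ++ [((a :: l).getLast (by simp), b)] := by
  induction l generalizing a with
  | nil => simp
  | cons x l ih => simpa using ih x

theorem cyclicPairs_cons (a : X) (l : List X) :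
    cyclicPairs (a :: l) = (a :: l).zip l ++ [((a :: l).getLast (by simp), a)] := by
  rw [← zip_append_singleton]
  simp [cyclicPairs]

theorem isChain_cons_iff_forall_mem_zip {R : X → X → Prop} (a : X) (l : List X) :
    (a :: l).IsChain R ↔ ∀ e ∈ (a :: l).zip l, R e.1 e.2 := by
  induction l generalizing a with
  | nil => simp
  | cons x l ih => simp [List.isChain_cons_cons, ih x]

theorem forall_cyclicPairs_iff {R : X → X → Prop} (T : List X) (hT : T ≠ []) :
    (∀ e ∈ cyclicPairs T, R e.1 e.2) ↔ T.IsChain R ∧ R (T.getLast hT) (T.head hT) := by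
  cases T with
  | nil => simp at hT
  | cons a l =>
    rw [cyclicPairs_cons, isChain_cons_iff_forall_mem_zip]
    simp only [List.mem_append, List.mem_singleton, or_imp, forall_and, forall_eq, List.head_cons]

theorem mem_cyclicPairs_iff {T : List X} {x y : X} :
    (x, y) ∈ cyclicPairs T ↔ ∃ (i : ℕ) (h : i < T.length),
      T[i] = x ∧ T[(i + 1) % T.length]'(Nat.mod_lt _ (by omega)) = y := by
  unfold cyclicPairs
  rw [List.mem_iff_getElem]
  simp [List.getElem_rotate, Prod.ext_iff]

theorem cyclicPairs_map {Y : Type*} (f : X → Y) (T : List X) :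
    cyclicPairs (T.map f) = (cyclicPairs T).map (Prod.map f f) := by
  simp [cyclicPairs, ← List.map_rotate, List.zip_map]

theorem nodup_cyclicPairs {T : List X} (hT : T.Nodup) : (cyclicPairs T).Nodup := by
  apply List.Nodup.of_map Prod.fst
  rw [cyclicPairs, List.map_fst_zip (by simp)]
  exact hT

theorem cyclicPairs_left_unique {T : List X} (hT : T.Nodup) {x y z : X}
    (hy : (x, y) ∈ cyclicPairs T) (hz : (x, z) ∈ cyclicPairs T) : y = z := by
  obtain ⟨i, hi, rfl, rfl⟩ := mem_cyclicPairs_iff.1 hy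
  obtain ⟨j, hj, h, rfl⟩ := mem_cyclicPairs_iff.1 hz
  obtain rfl := (hT.getElem_inj_iff).1 h
  rfl

theorem nodup_map_snd_cyclicPairs {T : List X} (hT : T.Nodup) :
    ((cyclicPairs T).map Prod.snd).Nodup := by
  rw [cyclicPairs, List.map_snd_zip (by simp)]
  simpa using hT

theorem cyclicPairs_right_unique {T : List X} (hT : T.Nodup) {x y z : X}
    (hy : (y, x) ∈ cyclicPairs T) (hz : (z, x) ∈ cyclicPairs T) : y = z := by
  have := List.inj_on_of_nodup_map (nodup_map_snd_cyclicPairs hT) hy hz rfl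
  exact congrArg Prod.fst this

theorem exists_cyclicPairs_left {T : List X} {x : X} (hx : x ∈ T) :
    ∃ y, (x, y) ∈ cyclicPairs T := by
  obtain ⟨i, hi, rfl⟩ := List.mem_iff_getElem.1 hx
  exact ⟨_, mem_cyclicPairs_iff.2 ⟨i, hi, rfl, rfl⟩⟩

theorem exists_cyclicPairs_right {T : List X} {x : X} (hx : x ∈ T) :
    ∃ y, (y, x) ∈ cyclicPairs T := by
  have h : x ∈ (cyclicPairs T).map Prod.snd := by
    rw [cyclicPairs, List.map_snd_zip (by simp)]
    simpa using hx
  obtain ⟨⟨y, z⟩, hyz, rfl⟩ := List.mem_map.1 h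
  exact ⟨y, hyz⟩

/-- A cycle of length at least `3` does not use an arc together with its reverse. -/
theorem cyclicPairs_asymm {T : List X} (hT : T.Nodup) (h3 : 3 ≤ T.length) {x y : X}
    (h : (x, y) ∈ cyclicPairs T) : (y, x) ∉ cyclicPairs T := by
  intro h'
  obtain ⟨i, hi, rfl, rfl⟩ := mem_cyclicPairs_iff.1 h
  obtain ⟨j, hj, h1, h2⟩ := mem_cyclicPairs_iff.1 h'
  have e1 := (hT.getElem_inj_iff).1 h1
  have e2 := (hT.getElem_inj_iff).1 h2
  rcases Nat.lt_or_ge (i + 1) T.length with h4 | h4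
  · rw [Nat.mod_eq_of_lt h4] at e1
    subst e1
    rcases Nat.lt_or_ge (i + 1 + 1) T.length with h5 | h5
    · rw [Nat.mod_eq_of_lt h5] at e2; omega
    · have : i + 1 + 1 = T.length := by omega
      rw [this, Nat.mod_self] at e2; omega
  · have h5 : i + 1 = T.length := by omega
    rw [h5, Nat.mod_self] at e1
    subst e1
    rw [Nat.mod_eq_of_lt (by omega)] at e2; omega

end CyclicPairs

/-! ### Cyclic reduction of a list -/

section CyclicReduce

variable {X : Type*} [DecidableEq X]

theorem head?_destutter' (a : X) (l : List X) :
    (l.destutter' (· ≠ ·) a).head? = some a := by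
  induction l generalizing a with
  | nil => simp
  | cons x l ih => rw [List.destutter'_cons]; split_ifs <;> simp [ih]

theorem getLast?_destutter' (a : X) (l : List X) :
    (l.destutter' (· ≠ ·) a).getLast? = (a :: l).getLast? := by
  induction l generalizing a with
  | nil => simp
  | cons x l ih =>
    rw [List.destutter'_cons]
    split_ifs with h
    · rw [List.getLast?_cons, ih, List.getLast?_cons_cons]
      simp [List.getLast?_cons]
    · rw [ih]
      obtain rfl : a = x := by simpa using h
      simp [List.getLast?_cons]

theorem mem_destutter'_iff (a x : X) (l : List X) :
    x ∈ l.destutter' (· ≠ ·) a ↔ x ∈ a :: l := by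
  induction l generalizing a with
  | nil => simp
  | cons y l ih =>
    rw [List.destutter'_cons]
    split_ifs with h
    · simp [ih]
    · obtain rfl : a = y := by simpa using h
      simp [ih]

theorem isChain_destutter'_of_isChain {R : X → X → Prop} (a : X) (l : List X)
    (h : (a :: l).IsChain fun x y => x ≠ y → R x y) :
    (l.destutter' (· ≠ ·) a).IsChain R := by
  induction l generalizing a with
  | nil => simp
  | cons y l ih =>
    rw [List.isChain_cons_cons] at h
    rw [List.destutter'_cons]
    split_ifs with hy
    · rw [List.isChain_cons]
      refine ⟨fun z hz => ?_, ih _ h.2⟩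
      rw [head?_destutter'] at hz
      obtain rfl : y = z := by simpa using hz
      exact h.1 hy
    · obtain rfl : a = y := by simpa using hy
      exact ih _ h.2

theorem count_destutter' (v a : X) (l : List X) :
    (l.destutter' (· ≠ ·) a).count v = (if a = v then 1 else 0) +
      ((a :: l).zip l).countP fun e => e.1 ≠ v ∧ e.2 = v := by
  induction l generalizing a with
  | nil => simp [List.count_singleton]
  | cons y l ih =>
    rw [List.destutter'_cons, List.zip_cons_cons, List.countP_cons]
    split_ifs with h1 h2 h3 h4 h5 h6 <;> simp_all <;> grind

/-- `cyclicReduce` on a list that is not constant: it keeps the set of entries, turns a cyclic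
chain for "equal or related" into a cyclic chain for the relation, and its entries `v` are
in bijection with the places where the cyclic list steps from another entry to `v`. -/
theorem cyclicReduce_spec {l : List X} {x y : X} (hx : x ∈ l) (hy : y ∈ l) (hxy : x ≠ y) :
    (∀ z, z ∈ cyclicReduce l ↔ z ∈ l) ∧
    (∀ v, (cyclicReduce l).count v =
      (cyclicPairs l).countP fun e => e.1 ≠ v ∧ e.2 = v) ∧
    ∀ R : X → X → Prop, (∀ e ∈ cyclicPairs l, e.1 ≠ e.2 → R e.1 e.2) →
      ∃ h : cyclicReduce l ≠ [], (cyclicReduce l).IsChain R ∧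
        R ((cyclicReduce l).getLast h) ((cyclicReduce l).head h) := by
  cases l with
  | nil => simp at hx
  | cons a l =>
  have hR : ∀ R : X → X → Prop, (∀ e ∈ cyclicPairs (a :: l), e.1 ≠ e.2 → R e.1 e.2) →
      (l.destutter' (· ≠ ·) a).IsChain R ∧
        ((a :: l).getLast (by simp) ≠ a → R ((a :: l).getLast (by simp)) a) := by
    intro R h
    have := (forall_cyclicPairs_iff (R := fun x y => x ≠ y → R x y) _ (by simp)).1 h
    exact ⟨isChain_destutter'_of_isChain _ _ this.1, this.2⟩
  have hcount := fun v => count_destutter' v a l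
  have hmem := fun z => mem_destutter'_iff a z l
  have hhead := head?_destutter' a l
  have hlast := getLast?_destutter' a l
  rw [List.getLast?_eq_some_getLast (l := a :: l) (by simp)] at hlast
  rw [cyclicPairs_cons] at *
  have hred : cyclicReduce (a :: l) =
      if 2 ≤ (l.destutter' (· ≠ ·) a).length ∧
        (l.destutter' (· ≠ ·) a).head? = (l.destutter' (· ≠ ·) a).getLast?
      then (l.destutter' (· ≠ ·) a).dropLast else l.destutter' (· ≠ ·) a := rfl
  generalize (a :: l).getLast _ = b at *
  generalize l.destutter' (· ≠ ·) a = r at *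
  rw [← hmem] at hx hy
  rw [hred, hhead, hlast]
  obtain ⟨s, rfl⟩ : ∃ s, r = s ++ [b] := ⟨r.dropLast, by
    obtain ⟨hne, hb⟩ := List.getLast?_eq_some_iff.1 hlast
    simp [hb]⟩
  cases s with
  | nil => simp_all
  | cons a' s =>
  obtain rfl : a' = a := by simpa using hhead
  -- the first and the last block agree exactly if `r` starts and ends with the same entry
  by_cases hab : a' = b
  · subst hab
    rw [if_pos ⟨by simp, rfl⟩, List.dropLast_concat]
    refine ⟨fun z => ?_, fun v => ?_, fun R h => ⟨by simp, ?_⟩⟩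
    · rw [← hmem]; simp; tauto
    · have := hcount v
      rw [List.count_append] at this
      simp only [List.count_singleton] at this
      rw [List.countP_append]
      simp at this ⊢
      grind
    · have h1 := (hR R h).1
      rw [List.isChain_append] at h1
      exact ⟨h1.1, h1.2.2 _ (List.getLast?_eq_some_getLast (by simp)) _ (by simp)⟩
  · rw [if_neg (by simp [hab])]
    refine ⟨hmem, fun v => ?_, fun R h => ⟨by simp, (hR R h).1, ?_⟩⟩
    · rw [hcount, List.countP_append, List.countP_singleton, add_comm]
      grind
    · simpa using (hR R h).2 (Ne.symm hab)

end CyclicReduce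

/-! ### Walks as lists -/

section Walks

variable {V : Type*} [Fintype V] [DecidableEq V] {G : SimpleGraph V}

/-- A list that visits every vertex and is a cyclic chain for adjacency is the support of an
Unbounded Hamiltonian Cycle. -/
theorem exists_isUnboundedHamCycle_of_list (l : List V) (hne : l ≠ []) (hmem : ∀ w, w ∈ l)
    (hchain : l.IsChain G.Adj) (hclose : G.Adj (l.getLast hne) (l.head hne)) :
    ∃ (u v : V) (p : G.Walk u v), p.support = l ∧
      IsUnboundedHamCycle (Finset.univ.filter fun w => 2 ≤ l.count w).card p := by
  have hs := SimpleGraph.Walk.support_ofSupport hne hchain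
  refine ⟨_, _, SimpleGraph.Walk.ofSupport l hne hchain, hs, ⟨?_, ?_⟩, hclose⟩
  · rw [hs]; exact hmem
  · rw [unboundedVertices, hs]

theorem IsUnboundedHamCycle.nontrivial {k : ℕ} {u v : V} {p : G.Walk u v}
    (h : IsUnboundedHamCycle k p) : Nontrivial V :=
  ⟨⟨_, _, h.2.ne⟩⟩

/-- If each stretch strictly between two consecutive occurrences of `v` contains an entry that
occurs nowhere else, then these entries and `v` are distinct, so that `v` occurs at most as often
as there are distinct entries. -/
theorem count_le_card_toFinset {X : Type*} [DecidableEq X] (v : X) (l : List X)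
    (h : ∀ A s B, l = A ++ v :: s ++ v :: B → ∃ w ∈ s, w ∉ A ++ v :: B) :
    l.count v ≤ l.toFinset.card := by
  induction hn : l.length using Nat.strong_induction_on generalizing l with
  | _ n ih =>
  cases l with
  | nil => simp
  | cons x l =>
  simp only [List.length_cons] at hn
  by_cases hx : x = v
  · subst hx
    by_cases hl : x ∈ l
    · obtain ⟨s, B, rfl, hs⟩ := List.eq_append_cons_of_mem hl
      obtain ⟨w, hw, hwB⟩ := h [] s B (by simp)
      have h1 := ih (x :: B).length (by simp at hn ⊢; omega) (x :: B) (by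
        intro A t C hC
        obtain ⟨z, hz, hz'⟩ := h (x :: s ++ A) t C (by simp [hC])
        exact ⟨z, hz, fun hh => hz' (by simp at hh ⊢; tauto)⟩) rfl
      -- `w` occurs only in the first stretch, so it is a new entry compared with `x :: B`
      have h2 : insert w (x :: B).toFinset ⊆ (x :: (s ++ x :: B)).toFinset := by
        intro z hz
        simp at hz ⊢
        grind
      have h3 := Finset.card_le_card h2
      rw [Finset.card_insert_of_notMem (by simpa using hwB)] at h3
      have h4 : s.count x = 0 := List.count_eq_zero.2 hs
      simp only [List.count_cons, List.count_append, h4] at h1 ⊢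
      simp at h1 ⊢
      simp at h3
      omega
    · rw [List.count_cons_self, List.count_eq_zero.2 hl]
      exact Finset.card_pos.2 ⟨x, by simp⟩
  · have h1 := ih l.length (by omega) l (by
      intro A t C hC
      obtain ⟨z, hz, hz'⟩ := h (x :: A) t C (by simp [hC])
      exact ⟨z, hz, fun hh => hz' (by simp at hh ⊢; tauto)⟩) rfl
    rw [List.count_cons_of_ne hx]
    exact h1.trans (Finset.card_le_card (by intro z; simp; tauto))

/-- Some Unbounded Hamiltonian Cycle with the least number of unbounded vertices visits no vertex
more than `|V|` times: in a shortest one, a stretch between two visits to the same vertex cannot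
be cut out. -/
theorem exists_isUnboundedHamCycle_count_le {m : ℕ} (hm : IsMinUnbounded G m) :
    ∃ (u v : V) (p : G.Walk u v), IsUnboundedHamCycle m p ∧
      ∀ w, p.support.count w ≤ Fintype.card V := by
  obtain ⟨⟨u, v, p, hp⟩, hmin⟩ := hm
  induction hn : p.support.length using Nat.strong_induction_on generalizing u v p with
  | _ n ih =>
  by_cases hc : ∀ w, p.support.count w ≤ Fintype.card V
  · exact ⟨u, v, p, hp, hc⟩
  push Not at hc
  obtain ⟨w, hw⟩ := hc
  have hcut : ∃ A s B, p.support = A ++ w :: s ++ w :: B ∧ ∀ z ∈ s, z ∈ A ++ w :: B := by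
    by_contra hcon
    push Not at hcon
    have := count_le_card_toFinset w p.support hcon
    exact absurd (this.trans (Finset.card_le_univ _)) (by omega)
  obtain ⟨A, s, B, hs, hsub⟩ := hcut
  have hch := p.isChain_adj_support
  have hhead : (A ++ w :: B).head (by simp) = u := by
    have : p.support.head (by simp) = u := by simp
    rw [← this]
    simp only [hs]
    cases A <;> simp
  have hlast : (A ++ w :: B).getLast (by simp) = v := by
    have : p.support.getLast (by simp) = v := by simp
    rw [← this]
    simp only [hs]
    simp
  have hchain : (A ++ w :: B).IsChain G.Adj := by
    rw [hs] at hch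
    have h2 := List.isChain_split.1 hch
    rw [List.append_assoc, List.cons_append] at hch
    exact List.isChain_split.2 ⟨(List.isChain_split.1 hch).1, h2.2⟩
  obtain ⟨u', v', q, hq, hqc⟩ := exists_isUnboundedHamCycle_of_list (G := G) (A ++ w :: B)
    (by simp) (fun z => by
      have := hp.1.1 z
      rw [hs] at this
      simp at this hsub ⊢
      grind) hchain (by rw [hhead, hlast]; exact hp.2)
  have hle : (Finset.univ.filter fun z => 2 ≤ (A ++ w :: B).count z).card ≤ m := by
    rw [← hp.1.2]
    apply Finset.card_le_card
    intro z
    simp only [unboundedVertices, Finset.mem_filter, Finset.mem_univ, true_and, hs]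
    simp only [List.count_append, List.count_cons]
    omega
  have hge := hmin ⟨u', v', q, hqc⟩
  rw [le_antisymm hle hge] at hqc
  exact ih q.support.length (by rw [← hn, hq, hs]; simp) u' v' q hqc rfl

end Walks

/-! ### Counting arcs -/

section ArcCount

theorem ncard_isOutPort {n : ℕ} (hn : 0 < n) : {x : Pos n | IsOutPort x}.ncard = n + 1 := by
  have : {x : Pos n | IsOutPort x} =
      insert (⟨0, hn⟩, Row.a) ((fun i => (i, Row.c)) '' Set.univ) := by
    ext ⟨i, r⟩
    simp [IsOutPort, Fin.ext_iff, and_comm, or_comm, eq_comm]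
  rw [this, Set.ncard_insert_of_notMem (by simp),
    Set.ncard_image_of_injective _ (fun i j h => by simpa using h), Set.ncard_univ]
  simp

theorem ncard_isInPort {n : ℕ} (hn : 0 < n) : {x : Pos n | IsInPort x}.ncard = n + 1 := by
  have : {x : Pos n | IsInPort x} =
      insert (⟨n - 1, by omega⟩, Row.c) ((fun i => (i, Row.a)) '' Set.univ) := by
    ext ⟨i, r⟩
    have h : (i : ℕ) + 1 = n ↔ (i : ℕ) = n - 1 := by omega
    simp [IsInPort, Fin.ext_iff, h, and_comm, or_comm, eq_comm (a := Row.a)]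
  rw [this, Set.ncard_insert_of_notMem (by simp),
    Set.ncard_image_of_injective _ (fun i j h => by simpa using h), Set.ncard_univ]
  simp

theorem ncard_innerEdge {n : ℕ} : {e : Pos n × Pos n | InnerEdge e.1 e.2}.ncard = 3 * n - 1 := by
  cases n with
  | zero => simp [Set.eq_empty_of_isEmpty]
  | succ k =>
  let f : Fin (k + 1) ⊕ Fin (k + 1) ⊕ Fin k → Pos (k + 1) × Pos (k + 1) := fun
    | .inl i => ((i, Row.a), (i, Row.b))
    | .inr (.inl i) => ((i, Row.b), (i, Row.c))
    | .inr (.inr i) => ((i.succ, Row.a), (i.castSucc, Row.c))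
  have hf : Function.Injective f := by
    rintro (i | i | i) (j | j | j) h <;> simp [f] at h <;> simp [h]
  have hr : {e : Pos (k + 1) × Pos (k + 1) | InnerEdge e.1 e.2} = f '' Set.univ := by
    ext ⟨⟨i, r⟩, ⟨j, s⟩⟩
    simp only [InnerEdge, Set.mem_ofPred_eq, Set.image_univ, Set.mem_range, Sum.exists]
    constructor
    · rintro (⟨rfl, rfl, rfl⟩ | ⟨rfl, rfl, rfl⟩ | ⟨rfl, rfl, h⟩)
      · exact Or.inl ⟨_, rfl⟩
      · exact Or.inr (Or.inl ⟨_, rfl⟩)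
      · refine Or.inr (Or.inr ⟨⟨j, by omega⟩, ?_⟩)
        simp [f, Fin.ext_iff, h]
    · rintro (⟨i, h⟩ | ⟨i, h⟩ | ⟨i, h⟩) <;> simp only [f, Prod.mk.injEq] at h <;>
        obtain ⟨⟨rfl, rfl⟩, rfl, rfl⟩ := h <;> simp
  rw [hr, Set.ncard_image_of_injective _ hf, Set.ncard_univ]
  simp
  omega

theorem InnerEdge.asymm {n : ℕ} {x y : Pos n} (h : InnerEdge x y) : ¬ InnerEdge y x := by
  unfold InnerEdge at *
  grind

theorem ncard_innerEdge_or {n : ℕ} :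
    {e : Pos n × Pos n | InnerEdge e.1 e.2 ∨ InnerEdge e.2 e.1}.ncard = 2 * (3 * n - 1) := by
  have : {e : Pos n × Pos n | InnerEdge e.1 e.2 ∨ InnerEdge e.2 e.1} =
      {e | InnerEdge e.1 e.2} ∪ Prod.swap '' {e | InnerEdge e.1 e.2} := by
    ext ⟨x, y⟩
    rw [Set.image_swap_eq_preimage_swap]
    rfl
  rw [this, Set.ncard_union_eq, Set.ncard_image_of_injective _ Prod.swap_injective,
    ncard_innerEdge, two_mul]
  rw [Set.disjoint_left]
  rintro ⟨x, y⟩ h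
  rw [Set.image_swap_eq_preimage_swap]
  exact h.asymm

variable {V : Type*} [Fintype V]

theorem ncard_adj_pairs (G : SimpleGraph V) :
    {e : V × V | G.Adj e.1 e.2}.ncard = 2 * G.edgeSet.ncard := by
  classical
  have h : {e : V × V | G.Adj e.1 e.2} = Set.range (SimpleGraph.Dart.toProd (G := G)) := by
    ext e
    exact ⟨fun h => ⟨⟨e, h⟩, rfl⟩, by rintro ⟨d, rfl⟩; exact d.adj⟩
  rw [h, ← Set.image_univ, Set.ncard_image_of_injective _ SimpleGraph.Dart.toProd_injective,
    Set.ncard_univ, Nat.card_eq_fintype_card, G.dart_card_eq_twice_card_edges,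
    ← SimpleGraph.coe_edgeFinset, Set.ncard_coe_finset]

theorem ncard_atspDigraph_adj [Nonempty V] (G : SimpleGraph V) :
    {e : AtspVertex V × AtspVertex V | (atspDigraph G).Adj e.1 e.2}.ncard =
      2 * G.edgeSet.ncard * (Fintype.card V + 1) ^ 2
        + 2 * Fintype.card V * (3 * Fintype.card V - 1) := by
  let f : V × (Pos (Fintype.card V) × Pos (Fintype.card V)) → AtspVertex V × AtspVertex V :=
    fun z => ((z.1, z.2.1), (z.1, z.2.2))
  let g : (V × V) × (Pos (Fintype.card V) × Pos (Fintype.card V)) →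
    AtspVertex V × AtspVertex V := fun z => ((z.1.1, z.2.1), (z.1.2, z.2.2))
  have hf : Function.Injective f := by
    rintro ⟨v, x, y⟩ ⟨v', x', y'⟩ h
    simp only [f, Prod.mk.injEq] at h ⊢
    tauto
  have hg : Function.Injective g := by
    rintro ⟨⟨v, w⟩, x, y⟩ ⟨⟨v', w'⟩, x', y'⟩ h
    simp only [g, Prod.mk.injEq] at h ⊢
    tauto
  have h : {e : AtspVertex V × AtspVertex V | (atspDigraph G).Adj e.1 e.2} =
      g '' ({e : V × V | G.Adj e.1 e.2} ×ˢ
        ({x | IsOutPort x} ×ˢ {y | IsInPort y})) ∪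
      f '' (Set.univ ×ˢ {e | InnerEdge e.1 e.2 ∨ InnerEdge e.2 e.1}) := by
    ext ⟨⟨v, x⟩, ⟨w, y⟩⟩
    constructor
    · rintro (⟨h1, h⟩ | ⟨h, h1, h2⟩)
      · obtain rfl : v = w := h1
        exact Or.inr ⟨(v, x, y), ⟨trivial, h⟩, rfl⟩
      · exact Or.inl ⟨((v, w), x, y), ⟨h, h1, h2⟩, rfl⟩
    · rintro (⟨⟨⟨v', w'⟩, x', y'⟩, h, e⟩ | ⟨⟨v', x', y'⟩, h, e⟩) <;>
        simp only [f, g, Prod.mk.injEq] at e <;> obtain ⟨⟨rfl, rfl⟩, rfl, rfl⟩ := e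
      · exact Or.inr h
      · exact Or.inl ⟨rfl, h.2⟩
  rw [h, Set.ncard_union_eq, Set.ncard_image_of_injective _ hg,
    Set.ncard_image_of_injective _ hf, Set.ncard_prod, Set.ncard_prod, Set.ncard_prod,
    ncard_adj_pairs, ncard_isOutPort Fintype.card_pos, ncard_isInPort Fintype.card_pos,
    ncard_innerEdge_or, Set.ncard_univ, Nat.card_eq_fintype_card]
  · ring
  · rw [Set.disjoint_left]
    rintro _ ⟨⟨⟨v, w⟩, x, y⟩, hz, rfl⟩ ⟨⟨v', x', y'⟩, -, hz'⟩
    simp only [f, g, Prod.mk.injEq] at hz'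
    exact G.ne_of_adj hz.1 (hz'.1.1.symm.trans hz'.2.1)

end ArcCount

/-! ### The shape of a tour inside a gadget -/

section Gadget

variable {V : Type*} [Fintype V] {G : SimpleGraph V}
  {T : List (AtspVertex V)} {v : V} {i : Fin (Fintype.card V)}

/-- The tour `T` runs upwards through column `i` of the gadget of `v`. -/
def IsUpColumn (T : List (AtspVertex V)) (v : V) (i : Fin (Fintype.card V)) : Prop :=
  ((v, i, Row.c), (v, i, Row.b)) ∈ cyclicPairs T ∧
    ((v, i, Row.b), (v, i, Row.a)) ∈ cyclicPairs T

theorem card_atspVertex : Fintype.card (AtspVertex V) = 3 * Fintype.card V ^ 2 := by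
  have : Fintype.card Row = 3 := rfl
  simp [this]
  ring

theorem length_tour (hT : IsTour (atspDigraph G) T) :
    T.length = 3 * Fintype.card V ^ 2 := by
  classical
  have h : T.toFinset = Finset.univ := by
    ext x
    simp [hT.2.2.1 x]
  rw [← List.toFinset_card_of_nodup hT.2.1, h, Finset.card_univ, card_atspVertex]

theorem three_le_length_tour (hT : IsTour (atspDigraph G) T) : 3 ≤ T.length := by
  have h1 := length_tour hT
  have h2 := List.length_pos_iff.2 hT.1
  have : Fintype.card V ^ 2 ≠ 0 := by
    intro h
    omega
  omega

theorem IsTour.adj (hT : IsTour (atspDigraph G) T) {x y : AtspVertex V}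
    (h : (x, y) ∈ cyclicPairs T) : (atspDigraph G).Adj x y :=
  hT.2.2.2 _ h

theorem adj_b_right {y : AtspVertex V} (h : (atspDigraph G).Adj (v, i, Row.b) y) :
    y = (v, i, Row.a) ∨ y = (v, i, Row.c) := by
  obtain ⟨w, j, r⟩ := y
  simp only [atspDigraph, InnerEdge, IsOutPort] at h
  simp
  grind

theorem adj_b_left {y : AtspVertex V} (h : (atspDigraph G).Adj y (v, i, Row.b)) :
    y = (v, i, Row.a) ∨ y = (v, i, Row.c) := by
  obtain ⟨w, j, r⟩ := y
  simp only [atspDigraph, InnerEdge, IsInPort] at h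
  simp
  grind

theorem adj_a_right {y : AtspVertex V} (hi : (i : ℕ) ≠ 0)
    (h : (atspDigraph G).Adj (v, i, Row.a) y) :
    y = (v, i, Row.b) ∨ ∃ j : Fin (Fintype.card V), (i : ℕ) = j + 1 ∧ y = (v, j, Row.c) := by
  obtain ⟨w, j, r⟩ := y
  simp only [atspDigraph, InnerEdge, IsOutPort] at h
  simp
  grind

theorem adj_c_left {y : AtspVertex V} (hi : (i : ℕ) + 1 ≠ Fintype.card V)
    (h : (atspDigraph G).Adj y (v, i, Row.c)) :
    y = (v, i, Row.b) ∨ ∃ j : Fin (Fintype.card V), (j : ℕ) = i + 1 ∧ y = (v, j, Row.a) := by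
  obtain ⟨w, j, r⟩ := y
  simp only [atspDigraph, InnerEdge, IsInPort] at h
  simp
  grind

theorem isUpColumn_of_left (hT : IsTour (atspDigraph G) T)
    (h : ((v, i, Row.a), (v, i, Row.b)) ∉ cyclicPairs T) : IsUpColumn T v i := by
  have h3 := three_le_length_tour hT
  obtain ⟨y, hy⟩ := exists_cyclicPairs_right (hT.2.2.1 (v, i, Row.b))
  obtain ⟨z, hz⟩ := exists_cyclicPairs_left (hT.2.2.1 (v, i, Row.b))
  rcases adj_b_left (hT.adj hy) with rfl | rfl
  · exact absurd hy h
  refine ⟨hy, ?_⟩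
  rcases adj_b_right (hT.adj hz) with rfl | rfl
  · exact hz
  · exact absurd hz (cyclicPairs_asymm hT.2.1 h3 hy)

theorem isUpColumn_of_right (hT : IsTour (atspDigraph G) T)
    (h : ((v, i, Row.b), (v, i, Row.c)) ∉ cyclicPairs T) : IsUpColumn T v i := by
  refine isUpColumn_of_left hT fun h' => ?_
  obtain ⟨z, hz⟩ := exists_cyclicPairs_left (hT.2.2.1 (v, i, Row.b))
  rcases adj_b_right (hT.adj hz) with rfl | rfl
  · exact cyclicPairs_asymm hT.2.1 (three_le_length_tour hT) h' hz
  · exact h hz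

/-- A tour that runs upwards through a column leaves its top vertex towards the column before. -/
theorem IsUpColumn.arc_left (hT : IsTour (atspDigraph G) T) (h : IsUpColumn T v i)
    {j : Fin (Fintype.card V)} (hj : (i : ℕ) = j + 1) :
    ((v, i, Row.a), (v, j, Row.c)) ∈ cyclicPairs T := by
  obtain ⟨z, hz⟩ := exists_cyclicPairs_left (hT.2.2.1 (v, i, Row.a))
  rcases adj_a_right (by omega) (hT.adj hz) with rfl | ⟨k, hk, rfl⟩
  · exact absurd hz (cyclicPairs_asymm hT.2.1 (three_le_length_tour hT) h.2)
  · obtain rfl : k = j := Fin.ext (by omega)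
    exact hz

theorem IsUpColumn.arc_right (hT : IsTour (atspDigraph G) T) (h : IsUpColumn T v i)
    {j : Fin (Fintype.card V)} (hj : (j : ℕ) = i + 1) :
    ((v, j, Row.a), (v, i, Row.c)) ∈ cyclicPairs T := by
  obtain ⟨z, hz⟩ := exists_cyclicPairs_right (hT.2.2.1 (v, i, Row.c))
  rcases adj_c_left (by omega) (hT.adj hz) with rfl | ⟨k, hk, rfl⟩
  · exact absurd hz (cyclicPairs_asymm hT.2.1 (three_le_length_tour hT) h.1)
  · obtain rfl : k = j := Fin.ext (by omega)
    exact hz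

theorem IsUpColumn.pred (hT : IsTour (atspDigraph G) T) (h : IsUpColumn T v i)
    {j : Fin (Fintype.card V)} (hj : (i : ℕ) = j + 1) : IsUpColumn T v j :=
  isUpColumn_of_right hT fun h' => by
    simpa using cyclicPairs_right_unique hT.2.1 h' (h.arc_left hT hj)

theorem IsUpColumn.succ (hT : IsTour (atspDigraph G) T) (h : IsUpColumn T v i)
    {j : Fin (Fintype.card V)} (hj : (j : ℕ) = i + 1) : IsUpColumn T v j :=
  isUpColumn_of_left hT fun h' => by
    simpa using cyclicPairs_left_unique hT.2.1 h' (h.arc_right hT hj)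

/-- The direction is the same in all columns of a gadget. -/
theorem IsUpColumn.all (hT : IsTour (atspDigraph G) T) (h : IsUpColumn T v i)
    (j : Fin (Fintype.card V)) : IsUpColumn T v j := by
  have hz : ∀ (k : ℕ) (hk : k < Fintype.card V), IsUpColumn T v ⟨k, hk⟩ →
      IsUpColumn T v ⟨0, by omega⟩ := by
    intro k
    induction k with
    | zero => exact fun _ h => h
    | succ k ih => exact fun hk h => ih (by omega) (h.pred hT rfl)
  have hs : ∀ (k : ℕ) (hk : k < Fintype.card V), IsUpColumn T v ⟨k, hk⟩ := by
    intro k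
    induction k with
    | zero => exact fun _ => hz i i.2 h
    | succ k ih => exact fun hk => (ih (by omega)).succ hT rfl
  exact hs j j.2

/-- A tour that avoids a single downward arc of a gadget avoids all of them. -/
theorem isUpColumn_of_notMem (hT : IsTour (atspDigraph G) T) {a : DownArc (Fintype.card V)}
    (h : ((v, a.tail), (v, a.head)) ∉ cyclicPairs T) (i : Fin (Fintype.card V)) :
    IsUpColumn T v i := by
  cases a with
  | ab j => exact (isUpColumn_of_left hT h).all hT i
  | bc j => exact (isUpColumn_of_right hT h).all hT i

/-- A gadget whose columns are run through upwards can be entered only at its last vertex `c`. -/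
theorem eq_c_last_of_entry (hT : IsTour (atspDigraph G) T)
    (h : ∀ i, IsUpColumn T v i) {x y : AtspVertex V} (hxy : (x, y) ∈ cyclicPairs T)
    (hx : x.1 ≠ v) (hy : y.1 = v) :
    y.2.2 = Row.c ∧ (y.2.1 : ℕ) + 1 = Fintype.card V := by
  obtain ⟨w, i, r⟩ := y
  obtain rfl : w = v := hy
  cases r with
  | a => exact absurd (by rw [cyclicPairs_right_unique hT.2.1 hxy (h i).2]) hx
  | b => exact absurd (by rw [cyclicPairs_right_unique hT.2.1 hxy (h i).1]) hx
  | c =>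
    refine ⟨rfl, ?_⟩
    by_contra hi
    have hlt : (i : ℕ) + 1 < Fintype.card V := by
      have := i.2
      simp only at hi
      omega
    exact absurd (by rw [cyclicPairs_right_unique hT.2.1 hxy
      ((h i).arc_right hT (j := ⟨i + 1, hlt⟩) rfl)]) hx

variable [DecidableEq V]

/-- A vertex whose gadget is run through upwards is entered at most once. -/
theorem countP_entry_le_one (hT : IsTour (atspDigraph G) T) (h : ∀ i, IsUpColumn T v i) :
    ((cyclicPairs (T.map Prod.fst)).countP fun e => e.1 ≠ v ∧ e.2 = v) ≤ 1 := by
  rw [cyclicPairs_map, List.countP_map]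
  by_cases hV : 0 < Fintype.card V
  · let y : AtspVertex V := (v, ⟨Fintype.card V - 1, by omega⟩, Row.c)
    calc _ ≤ (cyclicPairs T).countP ((· == y) ∘ Prod.snd) := by
          apply List.countP_mono_left
          rintro ⟨x, z⟩ hxz he
          simp only [Function.comp_apply, decide_eq_true_eq, Prod.map_fst, Prod.map_snd] at he
          obtain ⟨h1, h2⟩ := eq_c_last_of_entry hT h hxz he.1 he.2
          simp only [Function.comp_apply, beq_iff_eq, y]
          exact Prod.ext he.2 (Prod.ext (Fin.ext (by simp only; omega)) h1)
      _ = ((cyclicPairs T).map Prod.snd).count y := by rw [← List.countP_map]; rfl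
      _ ≤ 1 := List.nodup_iff_count_le_one.1 (nodup_map_snd_cyclicPairs hT.2.1) y
  · exact absurd (Fintype.card_pos_iff.2 ⟨v⟩) hV

/-- The weight of a tour is the number of gadgets whose chosen arc it uses. -/
theorem tourWeight_eq_card (d : V → DownArc (Fintype.card V)) (hT : T.Nodup) :
    tourWeight (atspWeight d) T =
      (Finset.univ.filter fun v =>
        ((v, (d v).tail), (v, (d v).head)) ∈ cyclicPairs T).card := by
  rw [tourWeight, ← List.sum_toFinset _ (nodup_cyclicPairs hT)]
  simp only [atspWeight]
  rw [← Finset.card_filter]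
  symm
  apply Finset.card_bij fun v _ => ((v, (d v).tail), (v, (d v).head))
  · intro v hv
    simpa using hv
  · intro v _ w _ h
    exact congrArg (fun e => e.1.1) h
  · rintro ⟨⟨v, x⟩, ⟨w, y⟩⟩ h
    simp only [Finset.mem_filter, List.mem_toFinset] at h
    obtain ⟨h, rfl, rfl, rfl⟩ := h
    exact ⟨v, by simpa using h, rfl⟩

/-- Reading off a tour gives an Unbounded Hamiltonian Cycle in which only vertices with a gadget
that is run through downwards are unbounded. -/
theorem exists_isUnboundedHamCycle_readOff [Nontrivial V] (d : V → DownArc (Fintype.card V))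
    (hT : IsTour (atspDigraph G) T) :
    ∃ k ≤ tourWeight (atspWeight d) T, ∃ (u v : V) (p : G.Walk u v),
      p.support = readOff T ∧ IsUnboundedHamCycle k p := by
  have hmem : ∀ v, v ∈ T.map Prod.fst := fun v =>
    List.mem_map.2 ⟨(v, ⟨0, Fintype.card_pos⟩, Row.a), hT.2.2.1 _, rfl⟩
  obtain ⟨x, y, hxy⟩ := exists_pair_ne V
  obtain ⟨h1, h2, h3⟩ := cyclicReduce_spec (hmem x) (hmem y) hxy
  obtain ⟨hne, hch, hcl⟩ := h3 G.Adj (by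
    intro e he hee
    rw [cyclicPairs_map] at he
    obtain ⟨⟨a, b⟩, hab, rfl⟩ := List.mem_map.1 he
    rcases hT.adj hab with h | h
    · exact absurd h.1 hee
    · exact h.1)
  refine ⟨_, ?_, exists_isUnboundedHamCycle_of_list (readOff T) hne
    (fun w => (h1 w).2 (hmem w)) hch hcl⟩
  rw [tourWeight_eq_card d hT.2.1]
  apply Finset.card_le_card
  intro v hv
  simp only [Finset.mem_filter, Finset.mem_univ, true_and] at hv ⊢
  by_contra hd
  have h := countP_entry_le_one hT (isUpColumn_of_notMem hT hd)
  rw [readOff, h2] at hv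
  omega

end Gadget

/-! ### The tour built from a walk -/

section Visits

variable {n : ℕ}

/-- The downward path through the given columns. -/
def downPath (s : List (Fin n)) : List (Pos n) :=
  s.flatMap fun i => [(i, Row.a), (i, Row.b), (i, Row.c)]

theorem mem_downPath {s : List (Fin n)} {x : Pos n} : x ∈ downPath s ↔ x.1 ∈ s := by
  obtain ⟨i, r⟩ := x
  simp only [downPath, List.mem_flatMap]
  cases r <;> simp

theorem nodup_downPath {s : List (Fin n)} (h : s.Nodup) : (downPath s).Nodup := by
  rw [downPath, List.nodup_flatMap]
  refine ⟨fun i _ => by simp, h.imp fun {i j} hij => ?_⟩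
  simp [Function.onFun, hij.symm]

theorem head?_downPath (s : List (Fin n)) :
    ∀ x ∈ (downPath s).head?, x.2 = Row.a ∧ x.1 ∈ s.head? := by
  cases s <;> simp [downPath]

theorem getLast?_downPath (s : List (Fin n)) :
    ∀ x ∈ (downPath s).getLast?, x.2 = Row.c ∧ x.1 ∈ s.getLast? := by
  induction s using List.reverseRecOn <;> simp [downPath]

theorem isChain_downPath {s : List (Fin n)} (h : s.IsChain fun i j : Fin n => (j : ℕ) = i + 1) :
    (downPath s).IsChain fun x y => InnerEdge x y ∨ InnerEdge y x := by
  induction s with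
  | nil => simp [downPath]
  | cons i s ih =>
    rw [List.isChain_cons] at h
    have : downPath (i :: s) = [(i, Row.a), (i, Row.b), (i, Row.c)] ++ downPath s := rfl
    rw [this, List.isChain_append]
    refine ⟨by simp [InnerEdge], ih h.2, fun x hx y hy => ?_⟩
    obtain ⟨h1, h2⟩ := head?_downPath s y hy
    obtain rfl : (i, Row.c) = x := by simpa using hx
    exact Or.inr (Or.inr (Or.inr ⟨h1, rfl, h.1 _ h2⟩))

/-- A step along the upward path `c_n, b_n, a_n, c_{n-1}, …, a_1` of a gadget. -/
def UpStep (x y : Pos n) : Prop :=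
  (x.2 = Row.c ∧ y.2 = Row.b ∧ x.1 = y.1) ∨ (x.2 = Row.b ∧ y.2 = Row.a ∧ x.1 = y.1) ∨
  (x.2 = Row.a ∧ y.2 = Row.c ∧ (x.1 : ℕ) = (y.1 : ℕ) + 1)

theorem UpStep.innerEdge_or {x y : Pos n} (h : UpStep x y) : InnerEdge x y ∨ InnerEdge y x := by
  unfold UpStep at h
  unfold InnerEdge
  grind

theorem not_upStep_downArc (a : DownArc n) : ¬ UpStep a.tail a.head := by
  cases a <;> simp [UpStep, DownArc.tail, DownArc.head]

theorem isChain_reverse_downPath {s : List (Fin n)}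
    (h : s.IsChain fun i j : Fin n => (j : ℕ) = i + 1) : (downPath s).reverse.IsChain UpStep := by
  rw [List.isChain_reverse]
  induction s with
  | nil => simp [downPath]
  | cons i s ih =>
    rw [List.isChain_cons] at h
    have : downPath (i :: s) = [(i, Row.a), (i, Row.b), (i, Row.c)] ++ downPath s := rfl
    rw [this, List.isChain_append]
    refine ⟨by simp [UpStep], ih h.2, fun x hx y hy => ?_⟩
    obtain ⟨h1, h2⟩ := head?_downPath s y hy
    obtain rfl : (i, Row.c) = x := by simpa using hx
    exact Or.inr (Or.inr ⟨h1, rfl, h.1 _ h2⟩)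

theorem isChain_finRange : (List.finRange n).IsChain fun i j : Fin n => (j : ℕ) = i + 1 := by
  rw [List.isChain_iff_getElem]
  simp

theorem mem_drop_finRange {j : ℕ} {i : Fin n} : i ∈ (List.finRange n).drop j ↔ j ≤ i := by
  rw [List.mem_drop_iff_getElem]
  constructor
  · rintro ⟨k, hk, rfl⟩
    simp
  · intro h
    exact ⟨i - j, by simp; omega, by ext; simp; omega⟩

theorem head?_drop_finRange {j : ℕ} {i : Fin n} (h : i ∈ ((List.finRange n).drop j).head?) :
    (i : ℕ) = j := by
  rw [List.head?_drop] at h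
  obtain ⟨hj, rfl⟩ := List.getElem?_eq_some_iff.1 h
  simp

/-- The part of a gadget that is run through when its vertex has been visited `j` times before:
if this is the only visit, the whole gadget upwards; if it is the last of several visits, all
remaining columns downwards; otherwise column `j` downwards. -/
def visit (n j : ℕ) (isLast : Prop) [Decidable isLast] : List (Pos n) :=
  if isLast then
    if j = 0 then (downPath (List.finRange n)).reverse
    else downPath ((List.finRange n).drop j)
  else downPath (((List.finRange n).drop j).take 1)

theorem mem_visit {j : ℕ} {isLast : Prop} [Decidable isLast] (hj : j < n) {x : Pos n} :
    x ∈ visit n j isLast ↔ j ≤ x.1 ∧ (isLast ∨ (x.1 : ℕ) = j) := by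
  unfold visit
  split_ifs with h1 h2
  · simp [mem_downPath, h1, h2]
  · simp [mem_downPath, mem_drop_finRange, h1]
  · have : ((List.finRange n).drop j).take 1 = [⟨j, hj⟩] := by
      rw [List.drop_eq_getElem_cons (by simpa using hj)]
      simp
    rw [mem_downPath, this]
    simp [h1, Fin.ext_iff]
    omega

theorem nodup_visit {j : ℕ} {isLast : Prop} [Decidable isLast] : (visit n j isLast).Nodup := by
  unfold visit
  have h := List.nodup_finRange n
  have h' : ((List.finRange n).drop j).Nodup := h.sublist (List.drop_sublist _ _)
  split_ifs with h1 h2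
  · exact List.nodup_reverse.2 (nodup_downPath h)
  · exact nodup_downPath h'
  · exact nodup_downPath (h'.sublist (List.take_sublist _ _))

theorem isChain_visit_of_only : (visit n 0 True).IsChain UpStep := by
  simpa [visit] using isChain_reverse_downPath isChain_finRange

theorem isChain_visit {j : ℕ} {isLast : Prop} [Decidable isLast] :
    (visit n j isLast).IsChain fun x y => InnerEdge x y ∨ InnerEdge y x := by
  unfold visit
  split_ifs with h1 h2
  · exact (isChain_reverse_downPath isChain_finRange).imp fun _ _ => UpStep.innerEdge_or
  · exact isChain_downPath (isChain_finRange.drop j)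
  · exact isChain_downPath ((isChain_finRange.drop j).take 1)

theorem isInPort_head?_visit {j : ℕ} {isLast : Prop} [Decidable isLast] :
    ∀ x ∈ (visit n j isLast).head?, IsInPort x := by
  unfold visit
  intro x hx
  split_ifs at hx with h1 h2
  · rw [List.head?_reverse] at hx
    obtain ⟨h3, h4⟩ := getLast?_downPath _ x hx
    refine Or.inr ⟨h3, ?_⟩
    rw [List.getLast?_eq_getElem?] at h4
    obtain ⟨h5, h6⟩ := List.getElem?_eq_some_iff.1 h4
    rw [← h6]
    have := x.1.2
    simp
    omega
  · exact Or.inl (head?_downPath _ x hx).1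
  · exact Or.inl (head?_downPath _ x hx).1

theorem isOutPort_getLast?_visit {j : ℕ} {isLast : Prop} [Decidable isLast] :
    ∀ x ∈ (visit n j isLast).getLast?, IsOutPort x := by
  unfold visit
  intro x hx
  split_ifs at hx with h1 h2
  · rw [List.getLast?_reverse] at hx
    obtain ⟨h3, h4⟩ := head?_downPath _ x hx
    exact Or.inr ⟨h3, head?_drop_finRange (j := 0) h4⟩
  · exact Or.inl (getLast?_downPath _ x hx).1
  · exact Or.inl (getLast?_downPath _ x hx).1

theorem visit_ne_nil {j : ℕ} {isLast : Prop} [Decidable isLast] (hj : j < n) :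
    visit n j isLast ≠ [] :=
  List.ne_nil_of_mem ((mem_visit hj (x := (⟨j, hj⟩, Row.a))).2 ⟨le_rfl, Or.inr rfl⟩)

end Visits

section BuildTour

variable {V : Type*} [Fintype V] [DecidableEq V] {G : SimpleGraph V}

/-- The gadget vertices met when following the list `l` of vertices of `G`, where `seen v` counts
the visits to `v` before the start of `l`. -/
def buildTour : (V → ℕ) → List V → List (AtspVertex V)
  | _, [] => []
  | seen, v :: l => (visit (Fintype.card V) (seen v) (v ∉ l)).map (Prod.mk v) ++
      buildTour (Function.update seen v (seen v + 1)) l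

/-- The steps allowed in the constructed tour, where `c v` is the number of visits to `v`: the
gadget of a vertex visited once is only run through upwards. -/
def TourStep (G : SimpleGraph V) (c : V → ℕ) (x y : AtspVertex V) : Prop :=
  (x.1 = y.1 ∧ (InnerEdge x.2 y.2 ∨ InnerEdge y.2 x.2) ∧ (c x.1 = 1 → UpStep x.2 y.2)) ∨
  (G.Adj x.1 y.1 ∧ IsOutPort x.2 ∧ IsInPort y.2)

/-- The bound says that the columns still available suffice for the visits still to come; all of
them are then used up. -/
theorem mem_buildTour {seen : V → ℕ} {l : List V}
    (h : ∀ v, seen v + l.count v ≤ Fintype.card V) (x : AtspVertex V) :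
    x ∈ buildTour seen l ↔ x.1 ∈ l ∧ seen x.1 ≤ x.2.1 := by
  obtain ⟨w, x⟩ := x
  induction l generalizing seen with
  | nil => simp [buildTour]
  | cons v l ih =>
    have hv : seen v < Fintype.card V := by
      have := h v
      rw [List.count_cons_self] at this
      omega
    rw [buildTour, List.mem_append, ih (fun u => by
      have := h u
      by_cases hu : u = v
      · subst hu; simp at this ⊢; omega
      · simpa [Function.update_of_ne hu, List.count_cons_of_ne (Ne.symm hu)] using this)]
    by_cases hw : w = v
    · subst hw
      simp only [List.mem_map, Prod.mk.injEq, true_and, exists_eq_right, mem_visit hv,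
        Function.update_self, List.mem_cons, true_or]
      have : seen w + 1 ≤ (x.1 : ℕ) ↔ seen w ≤ (x.1 : ℕ) ∧ (x.1 : ℕ) ≠ seen w := by omega
      rw [this]
      tauto
    · simp [hw, Ne.symm hw]

theorem nodup_buildTour {seen : V → ℕ} {l : List V}
    (h : ∀ v, seen v + l.count v ≤ Fintype.card V) : (buildTour seen l).Nodup := by
  induction l generalizing seen with
  | nil => simp [buildTour]
  | cons v l ih =>
    have hv : seen v < Fintype.card V := by
      have := h v
      rw [List.count_cons_self] at this
      omega
    have h' : ∀ u, Function.update seen v (seen v + 1) u + l.count u ≤ Fintype.card V := by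
      intro u
      have := h u
      by_cases hu : u = v
      · subst hu; simp at this ⊢; omega
      · simpa [Function.update_of_ne hu, List.count_cons_of_ne (Ne.symm hu)] using this
    rw [buildTour, List.nodup_append']
    refine ⟨nodup_visit.map (Prod.mk_right_injective v), ih h', ?_⟩
    intro x hx hx'
    rw [mem_buildTour h'] at hx'
    obtain ⟨y, hy, rfl⟩ := List.mem_map.1 hx
    rw [mem_visit hv] at hy
    simp at hx'
    have := hy.2.resolve_left (not_not.2 hx'.1)
    omega

theorem buildTour_spec {c seen : V → ℕ} {l : List V} (hc : ∀ v, seen v + l.count v = c v)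
    (hN : ∀ v, c v ≤ Fintype.card V) (hl : l.IsChain G.Adj) :
    (buildTour seen l).IsChain (TourStep G c) ∧
    (∀ x ∈ (buildTour seen l).head?, x.1 ∈ l.head? ∧ IsInPort x.2) ∧
    (∀ x ∈ (buildTour seen l).getLast?, x.1 ∈ l.getLast? ∧ IsOutPort x.2) := by
  induction l generalizing seen with
  | nil => simp [buildTour]
  | cons v l ih =>
    have hv : seen v < Fintype.card V := by
      have h1 := hc v
      have h2 := hN v
      rw [List.count_cons_self] at h1
      omega
    rw [List.isChain_cons] at hl
    obtain ⟨ih1, ih2, ih3⟩ := ih (seen := Function.update seen v (seen v + 1)) (by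
      intro u
      have := hc u
      by_cases hu : u = v
      · subst hu; simp at this ⊢; omega
      · simpa [Function.update_of_ne hu, List.count_cons_of_ne (Ne.symm hu)] using this) hl.2
    have hne := visit_ne_nil (isLast := v ∉ l) hv
    have hlast : ∀ x ∈ ((visit (Fintype.card V) (seen v) (v ∉ l)).map (Prod.mk v)).getLast?,
        x.1 = v ∧ IsOutPort x.2 := by
      intro x hx
      rw [List.getLast?_map] at hx
      obtain ⟨y, hy, rfl⟩ := Option.map_eq_some_iff.1 hx
      exact ⟨rfl, isOutPort_getLast?_visit y hy⟩
    rw [buildTour, List.isChain_append]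
    refine ⟨⟨?_, ih1, ?_⟩, ?_, ?_⟩
    · rw [List.isChain_map]
      by_cases h1 : c v = 1
      · have h2 := hc v
        rw [List.count_cons_self] at h2
        have h3 : v ∉ l := List.count_eq_zero.1 (by omega)
        have h4 : seen v = 0 := by omega
        have h5 := isChain_visit_of_only (n := Fintype.card V)
        simp only [h4, h3, not_false_eq_true]
        exact h5.imp fun x y h => Or.inl ⟨rfl, h.innerEdge_or, fun _ => h⟩
      · exact isChain_visit.imp fun x y h => Or.inl ⟨rfl, h, fun h' => absurd h' h1⟩
    · intro x hx y hy
      obtain ⟨h1, h2⟩ := hlast x hx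
      obtain ⟨h3, h4⟩ := ih2 y hy
      exact Or.inr ⟨h1 ▸ hl.1 _ h3, h2, h4⟩
    · intro x hx
      rw [List.head?_append_of_ne_nil _ (by simpa using hne), List.head?_map] at hx
      obtain ⟨y, hy, rfl⟩ := Option.map_eq_some_iff.1 hx
      exact ⟨by simp, isInPort_head?_visit y hy⟩
    · intro x hx
      cases l with
      | nil =>
        simp only [buildTour, List.append_nil] at hx
        obtain ⟨h1, h2⟩ := hlast x hx
        exact ⟨by simp [h1], h2⟩
      | cons w l =>
        rw [List.getLast?_cons_cons]
        apply ih3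
        rwa [List.getLast?_append_of_ne_nil] at hx
        rw [buildTour]
        have hw : Function.update seen v (seen v + 1) w < Fintype.card V := by
          have h1 := hc w
          have h2 := hN w
          by_cases hu : w = v
          · subst hu; simp at h1 ⊢; omega
          · rw [Function.update_of_ne hu]; simp [List.count_cons] at h1; omega
        simp [visit_ne_nil hw]

/-- An Unbounded Hamiltonian Cycle that visits no vertex more than `|V|` times gives a tour whose
weight is at most the number of unbounded vertices. -/
theorem exists_tour_of_isUnboundedHamCycle (d : V → DownArc (Fintype.card V)) {m : ℕ} {u v : V}
    {p : G.Walk u v} (hp : IsUnboundedHamCycle m p)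
    (hN : ∀ w, p.support.count w ≤ Fintype.card V) :
    ∃ T, IsTour (atspDigraph G) T ∧ tourWeight (atspWeight d) T ≤ m := by
  have hN' : ∀ w, (fun _ => 0 : V → ℕ) w + p.support.count w ≤ Fintype.card V := by simpa using hN
  obtain ⟨h1, h2, h3⟩ := buildTour_spec (G := G) (c := fun w => p.support.count w)
    (seen := fun _ => 0) (fun w => by simp) hN p.isChain_adj_support
  have hmem := mem_buildTour hN'
  have hnodup := nodup_buildTour hN'
  set T := buildTour (fun _ => 0) p.support
  have hall : ∀ x, x ∈ T := fun x => (hmem x).2 ⟨hp.1.1 _, Nat.zero_le _⟩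
  have hne : T ≠ [] :=
    List.ne_nil_of_mem (hall (u, ⟨0, Fintype.card_pos_iff.2 ⟨u⟩⟩, Row.a))
  have hstep := (forall_cyclicPairs_iff T hne).2 ⟨h1, by
    obtain ⟨h4, h5⟩ := h2 _ (List.head?_eq_some_head hne)
    obtain ⟨h6, h7⟩ := h3 _ (List.getLast?_eq_some_getLast hne)
    rw [List.head?_eq_some_head (by simp)] at h4
    rw [List.getLast?_eq_some_getLast (by simp)] at h6
    simp at h4 h6
    refine Or.inr ⟨?_, h7, h5⟩
    rw [← h4, ← h6]
    exact hp.2⟩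
  refine ⟨T, ⟨hne, hnodup, hall, fun e he => ?_⟩, ?_⟩
  · rcases hstep e he with h | h
    · exact Or.inl ⟨h.1, h.2.1⟩
    · exact Or.inr h
  · rw [tourWeight_eq_card d hnodup, ← hp.1.2]
    apply Finset.card_le_card
    intro w hw
    simp only [unboundedVertices, Finset.mem_filter, Finset.mem_univ, true_and] at hw ⊢
    have h4 : 0 < p.support.count w := List.count_pos_iff.2 (hp.1.1 w)
    by_contra h5
    rcases hstep _ hw with h | h
    -- a chosen arc is downwards, so it is not a step in the gadget of a vertex visited once
    · exact not_upStep_downArc _ (h.2.2 (by simp only; omega))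
    · exact G.ne_of_adj h.1 rfl

end BuildTour
end UnboundedHam

theorem mainTheorem9 {V : Type*} [Fintype V] [DecidableEq V] (G : SimpleGraph V)
    (d : V → UnboundedHam.DownArc (Fintype.card V))
    (m : ℕ) (hm : UnboundedHam.IsMinUnbounded G m) :
    -- number of vertices and number of arcs of the digraph
    Fintype.card (UnboundedHam.AtspVertex V) = 3 * Fintype.card V ^ 2 ∧
    Set.ncard {e : UnboundedHam.AtspVertex V × UnboundedHam.AtspVertex V |
        (UnboundedHam.atspDigraph G).Adj e.1 e.2} =
      2 * G.edgeSet.ncard * (Fintype.card V + 1) ^ 2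
        + 2 * Fintype.card V * (3 * Fintype.card V - 1) ∧
    -- the optimal tour weight exists and equals `m`
    IsLeast {w | ∃ T, UnboundedHam.IsTour (UnboundedHam.atspDigraph G) T ∧
        UnboundedHam.tourWeight (UnboundedHam.atspWeight d) T = w} m ∧
    -- every optimal tour yields an `m`-Unbounded Hamiltonian Cycle
    ∀ T, UnboundedHam.IsOptimalTour (UnboundedHam.atspDigraph G) (UnboundedHam.atspWeight d) T →
      ∃ (u v : V) (p : G.Walk u v),
        p.support = UnboundedHam.readOff T ∧ UnboundedHam.IsUnboundedHamCycle m p := by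
  open UnboundedHam in
  obtain ⟨u, v, p, hp, hN⟩ := exists_isUnboundedHamCycle_count_le hm
  have : Nontrivial V := hp.nontrivial
  obtain ⟨T, hT, hTm⟩ := exists_tour_of_isUnboundedHamCycle d hp hN
  have hlower : ∀ T', IsTour (atspDigraph G) T' → m ≤ tourWeight (atspWeight d) T' := by
    intro T' hT'
    obtain ⟨k, hk, h⟩ := exists_isUnboundedHamCycle_readOff d hT'
    obtain ⟨u', v', q, -, hq⟩ := h
    exact (hm.2 ⟨u', v', q, hq⟩).trans hk
  refine ⟨card_atspVertex, ncard_atspDigraph_adj G,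
    ⟨⟨T, hT, le_antisymm hTm (hlower T hT)⟩, ?_⟩, ?_⟩
  · rintro _ ⟨T', hT', rfl⟩
    exact hlower T' hT'
  · rintro T' ⟨hT', hopt⟩
    obtain ⟨k, hk, u', v', q, hq, hqc⟩ := exists_isUnboundedHamCycle_readOff d hT'
    obtain rfl : k = m :=
      le_antisymm (hk.trans ((hopt T hT).trans hTm)) (hm.2 ⟨u', v', q, hqc⟩)
    exact ⟨u', v', q, hq, hqc⟩
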